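/- For $q>0$ let $\zeta(z,q)$ be the Hurwitz zeta function, i.e. the analytic continuation to $z\in\mathbb{C}\setminus\{1\}$ of $\sum_{n\ge 0}(n+q)^{-z}$ ($\operatorname{Re} z>1$). For $k\in\mathbb{N}=\{1,2,\dots\}$ put $$A_k(q)=k\,\frac{\partial}{\partial z}\zeta(z,q)\Big|_{z=1-k},\qquad \psi^{(-k)}(q)=\frac{1}{k!}\bigl[A_k(q)-H_{k-1}B_k(q)\bigr],$$ where $H_r=\sum_{j=1}^{r}1/j$ (with $H_0=0$) are the harmonic numbers and $B_k(q)$ the Bernoulli polynomials, $\frac{te^{qt}}{e^t-1}=\sum_{m\ge0}B_m(q)\frac{t^m}{m!}$; the $\psi^{(-k)}$ are called the balanced negapolygamma functions. Let $\gamma$ be Euler's constant and $\zeta$ the Riemann zeta function. Then for all $k,k'\in\mathbb{N}$ the product $\psi^{(-k)}\psi^{(-k')}$ is integrable on $(0,1)$ and $$\int_0^1\psi^{(-k)}(q)\,\psi^{(-k')}(q)\,dq=\frac{2\cos\bigl((k-k')\frac{\pi}{2}\bigr)}{(2\pi)^{k+k'}}\Bigl[\zeta''(k+k')-2(\gamma+\ln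 2\pi)\,\zeta'(k+k')+\Bigl\{(\gamma+\ln 2\pi)^2+\frac{\pi^2}{4}\Bigr\}\zeta(k+k')\Bigr].$$ Moreover (from the case $k=k'=1$, where $\psi^{(-1)}(q)=\ln\Gamma(q)-\ln\sqrt{2\pi}$), $(\ln\Gamma)^2$ is integrable on $(0,1)$ and $$\int_0^1(\ln\Gamma(q))^2\,dq=\frac{\gamma^2}{12}+\frac{\pi^2}{48}+\frac13\gamma\ln\sqrt{2\pi}+\frac43\ln^2\sqrt{2\pi}-(\gamma+2\ln\sqrt{2\pi})\frac{\zeta'(2)}{\pi^2}+\frac{\zeta''(2)}{2\pi^2}.$$ -/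

import Mathlib

/-- The Hurwitz zeta function `ζ(z, q)` for real `q > 0`: the analytic continuation in `z` of
`∑ (n + q) ^ (-z)`. Mathlib's `HurwitzZeta.hurwitzZeta` is this function for `q ∈ (0, 1]`, extended
periodically in `q`; the finite sum undoes the periodic extension for `q > 1`, and it is empty
for `q ≤ 1`. -/
noncomputable def hurwitzZetaFn (z : ℂ) (q : ℝ) : ℂ :=
  HurwitzZeta.hurwitzZeta (q : UnitAddCircle) z -
    ∑ n ∈ Finset.range (⌈q⌉₊ - 1), 1 / ((q : ℂ) - ((n : ℂ) + 1)) ^ z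

/-- On `q ≤ 1` the correction is empty. -/
theorem hurwitzZetaFn_of_le_one (z : ℂ) {q : ℝ} (hq : q ≤ 1) :
    hurwitzZetaFn z q = HurwitzZeta.hurwitzZeta (q : UnitAddCircle) z := by
  have h : ⌈q⌉₊ - 1 = 0 := by
    have : ⌈q⌉₊ ≤ 1 := Nat.ceil_le.mpr (by simpa using hq)
    omega
  simp [hurwitzZetaFn, h]

/-- `hurwitzZetaFn` is given by the Hurwitz series where the series converges. -/
theorem hasSum_hurwitzZetaFn {z : ℂ} {q : ℝ} (hz : 1 < z.re) (hq : 0 < q) :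
    HasSum (fun n : ℕ => 1 / ((n : ℂ) + (q : ℂ)) ^ z) (hurwitzZetaFn z q) := by
  obtain ⟨m, hm⟩ : ∃ m, ⌈q⌉₊ = m + 1 :=
    Nat.exists_eq_succ_of_ne_zero (Nat.ceil_pos.mpr hq).ne'
  have h1 : (m : ℝ) < q := Nat.lt_ceil.mp (by omega)
  have h2 : q ≤ m + 1 := by
    have := Nat.le_ceil q
    rw [hm] at this
    exact_mod_cast this
  have key := HurwitzZeta.hasSum_hurwitzZeta_of_one_lt_re (a := q - m)
    ⟨by linarith, by linarith⟩ hz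
  have hper : ((q - m : ℝ) : UnitAddCircle) = (q : UnitAddCircle) := by
    have h0 : ((m : ℝ) : UnitAddCircle) = 0 := by
      rw [AddCircle.coe_eq_zero_iff]
      exact ⟨m, by simp⟩
    rw [AddCircle.coe_sub, h0, sub_zero]
  rw [hper] at key
  have key2 := (hasSum_nat_add_iff' m).mpr key
  unfold hurwitzZetaFn
  rw [hm, Nat.add_sub_cancel]
  have hf : (fun n : ℕ => 1 / (((n + m : ℕ) : ℂ) + ((q - m : ℝ) : ℂ)) ^ z) =
      fun n : ℕ => 1 / ((n : ℂ) + (q : ℂ)) ^ z := by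
    funext n
    have e : ((n + m : ℕ) : ℂ) + ((q - m : ℝ) : ℂ) = (n : ℂ) + (q : ℂ) := by
      push_cast
      ring
    rw [e]
  have hs : ∑ i ∈ Finset.range m, 1 / ((i : ℂ) + ((q - m : ℝ) : ℂ)) ^ z =
      ∑ n ∈ Finset.range m, 1 / ((q : ℂ) - ((n : ℂ) + 1)) ^ z := by
    rw [← Finset.sum_range_reflect]
    refine Finset.sum_congr rfl fun i hi => ?_
    have hi' : i + 1 ≤ m := Finset.mem_range.mp hi
    have e : ((m - 1 - i : ℕ) : ℂ) + ((q - m : ℝ) : ℂ) = (q : ℂ) - ((i : ℂ) + 1) := by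
      rw [Nat.sub_sub, Nat.cast_sub (by omega)]
      push_cast
      ring
    rw [e]
  rw [← hs, ← hf]
  exact key2

/-- `hurwitzZetaFn` is holomorphic in `z` away from its pole `z = 1`. -/
theorem differentiableAt_hurwitzZetaFn {z : ℂ} (q : ℝ) (hz : z ≠ 1) :
    DifferentiableAt ℂ (fun w => hurwitzZetaFn w q) z := by
  unfold hurwitzZetaFn
  refine (HurwitzZeta.differentiableAt_hurwitzZeta _ hz).sub
    (DifferentiableAt.fun_sum fun n hn => ?_)
  have hn' : n + 1 < ⌈q⌉₊ := by
    have := Finset.mem_range.mp hn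
    omega
  have h1 : ((n + 1 : ℕ) : ℝ) < q := Nat.lt_ceil.mp hn'
  have hne : (q : ℂ) - ((n : ℂ) + 1) ≠ 0 := by
    have h2 : q - ((n : ℝ) + 1) ≠ 0 := by
      push_cast at h1
      linarith
    exact_mod_cast h2
  have hpow : DifferentiableAt ℂ (fun w : ℂ => ((q : ℂ) - ((n : ℂ) + 1)) ^ w) z :=
    differentiableAt_id.const_cpow (Or.inl hne)
  exact (differentiableAt_const _).div hpow (by simp [Complex.cpow_eq_zero_iff, hne])

/-- `A_k(q) = k ∂ζ(z, q)/∂z` at `z = 1 - k`. -/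
noncomputable def hurwitzA (k : ℕ) (q : ℝ) : ℂ :=
  (k : ℂ) * deriv (fun z : ℂ => hurwitzZetaFn z q) (1 - (k : ℂ))

/-- The balanced negapolygamma function `ψ^{(-k)}(q) = (A_k(q) - H_{k-1} B_k(q)) / k!`, `k ≥ 1`,
with `H_r` the harmonic numbers and `B_k` the Bernoulli polynomials. -/
noncomputable def negapolygamma (k : ℕ) (q : ℝ) : ℂ :=
  (1 / (k.factorial : ℂ)) *
    (hurwitzA k q - (harmonic (k - 1) : ℂ) * Polynomial.aeval (q : ℂ) (Polynomial.bernoulli k))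

/-!
By Hurwitz's formula the `n`-th Fourier coefficient of `q ↦ ζ(1 - s, q)` is `(2πin)⁻ˢ Γ(s)`. For
`re s > 1` the Fourier series may be differentiated term by term in `s`, so for `k ≥ 2` the
coefficients of `∂ζ/∂z (1 - k, q)` follow from `Γ'(k) = (k - 1)! (H_{k-1} - γ)`. The Fourier
coefficients `-k! / (2πin)ᵏ` of `B_k` cancel the harmonic number, and the coefficients of `ψ^(-k)`
are `(γ + log (2πin)) / (2πin)ᵏ`. The case `k = 1` lies on the boundary of the half plane and is
reached by dominated convergence as `s → 1`: comparing `t⁻ᶻ` with its linear interpolation between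
consecutive integers continues `ζ(z, q) - ζ(z)` to `re z > -1`, bounds `∂ζ/∂z (z, q)` by
`C + |log q|` for `z` near `0` with `re z ≤ 0`, and yields Lerch's formula for `∂ζ/∂z (0, q)`.

Parseval's identity turns `∫ ψ^(-k) ψ^(-k')` into a sum over `n ≥ 1` of
`((γ + log 2π + log n)² + π²/4) / n^(k + k')`, and the powers of `log n` produce the derivatives
of `ζ`.
-/

section FourierSeries

open MeasureTheory AddCircle Set ComplexConjugate
open scoped Real Topology

variable {T : ℝ}

theorem continuous_of_hasSum_fourier {c : ℤ → ℂ} (hc : Summable c) {g : AddCircle T → ℂ}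
    (hg : ∀ x, HasSum (fun n => c n * fourier n x) (g x)) : Continuous g := by
  have hbound (n : ℤ) (x : AddCircle T) : ‖c n * fourier n x‖ ≤ ‖c n‖ := by
    rw [norm_mul, fourier_apply, Circle.norm_coe, mul_one]
  rw [funext fun x => (hg x).tsum_eq.symm]
  exact continuous_tsum (fun n => by fun_prop) hc.norm hbound

variable [hT : Fact (0 < T)]

theorem hasSum_fourierCoeff_neg_mul {f g : AddCircle T → ℂ} (hf : MemLp f 2 haarAddCircle)
    (hg : MemLp g 2 haarAddCircle) :
    HasSum (fun n : ℤ => fourierCoeff f (-n) * fourierCoeff g n)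
      (∫ t, f t * g t ∂haarAddCircle) := by
  have hf' : MemLp (fun t => conj (f t)) 2 (haarAddCircle (T := T)) := hf.star
  have parseval := (fourierBasis (T := T)).hasSum_inner_mul_inner hf'.toLp hg.toLp
  have integral_eq : inner ℂ hf'.toLp hg.toLp = ∫ t, f t * g t ∂haarAddCircle := by
    rw [L2.inner_def]
    refine integral_congr_ae ?_
    filter_upwards [hf'.coeFn_toLp, hg.coeFn_toLp] with t hft hgt
    simp [hft, hgt, mul_comm]
  have coeff_f (n : ℤ) : inner ℂ hf'.toLp (fourierBasis n) = fourierCoeff f (-n) := by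
    rw [coe_fourierBasis, L2.inner_def, fourierCoeff]
    refine integral_congr_ae ?_
    filter_upwards [hf'.coeFn_toLp, coeFn_fourierLp (T := T) 2 n] with t hft hnt
    rw [hft, hnt]
    simp
  have coeff_g (n : ℤ) : inner ℂ (fourierBasis n) hg.toLp = fourierCoeff g n := by
    rw [← HilbertBasis.repr_apply_apply, fourierBasis_repr, fourierCoeff_congr_ae hg.coeFn_toLp]
  simpa only [coeff_f, coeff_g, integral_eq] using parseval

theorem hasSum_fourierCoeffOn_neg_mul {a b : ℝ} (hab : a < b) {f g : ℝ → ℂ}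
    (hf : MemLp f 2 (volume.restrict (Ioc a b))) (hg : MemLp g 2 (volume.restrict (Ioc a b))) :
    HasSum (fun n : ℤ => fourierCoeffOn hab f (-n) * fourierCoeffOn hab g n)
      ((b - a)⁻¹ • ∫ x in a..b, f x * g x) := by
  have : Fact (0 < b - a) := ⟨sub_pos.mpr hab⟩
  rw [← add_sub_cancel a b] at hf hg
  have parseval :=
    hasSum_fourierCoeff_neg_mul hf.memLp_liftIoc.haarAddCircle hg.memLp_liftIoc.haarAddCircle
  have lift_mul (t : AddCircle (b - a)) : liftIoc (b - a) a f t * liftIoc (b - a) a g t =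
      liftIoc (b - a) a (fun x => f x * g x) t := rfl
  simpa only [fourierCoeff_liftIoc_eq, lift_mul, integral_haarAddCircle,
    integral_liftIoc_eq_intervalIntegral, add_sub_cancel] using parseval

theorem fourierCoeff_of_hasSum_fourier {c : ℤ → ℂ} (hc : Summable c) {g : AddCircle T → ℂ}
    (hg : ∀ x, HasSum (fun n => c n * fourier n x) (g x)) (m : ℤ) : fourierCoeff g m = c m := by
  have integral_term (n : ℤ) : ∫ x : AddCircle T, fourier (-m) x • (c n * fourier n x)
      ∂haarAddCircle = (Pi.single m (c m) : ℤ → ℂ) n := by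
    change fourierCoeff (fun x => c n * fourier n x) m = _
    rw [fourierCoeff.const_mul, fourierCoeff_fourier]
    rcases eq_or_ne n m with rfl | hnm
    · simp
    · simp [hnm, hnm.symm]
  have hsum : HasSum (Pi.single m (c m)) (∫ x, ∑' n, fourier (-m) x • (c n * fourier n x)
      ∂haarAddCircle (T := T)) := by
    rw [← funext integral_term]
    refine hasSum_integral_of_summable_integral_norm (fun n => ?_) ?_
    · exact Continuous.integrable_of_hasCompactSupport (by fun_prop) (.of_compactSpace _)
    · simp only [smul_eq_mul, norm_mul, fourier_apply, Circle.norm_coe, mul_one, one_mul]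
      simpa using hc.norm
  have fourierCoeff_eq : fourierCoeff g m =
      ∫ x, ∑' n, fourier (-m) x • (c n * fourier n x) ∂haarAddCircle (T := T) :=
    integral_congr_ae (.of_forall fun x => ((hg x).mul_left (fourier (-m) x)).tsum_eq.symm)
  rw [fourierCoeff_eq, hsum.unique (hasSum_pi_single m (c m))]

variable {E : Type*} [NormedAddCommGroup E] [NormedSpace ℂ E]

theorem fourierCoeffOn_add {a b : ℝ} (hab : a < b) {f g : ℝ → E}
    (hf : IntervalIntegrable f volume a b) (hg : IntervalIntegrable g volume a b) (n : ℤ) :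
    fourierCoeffOn hab (f + g) n = fourierCoeffOn hab f n + fourierCoeffOn hab g n := by
  have hfourier : ContinuousOn (fun x : ℝ => fourier (-n) (x : AddCircle (b - a))) (uIcc a b) :=
    ((map_continuous _).comp (AddCircle.continuous_mk' _)).continuousOn
  simp only [fourierCoeffOn_eq_integral, Pi.add_apply, smul_add]
  rw [intervalIntegral.integral_add (hf.continuousOn_smul hfourier)
    (hg.continuousOn_smul hfourier), smul_add]

theorem fourierCoeffOn_zero_left_eq_integral (f : ℝ → E) (n : ℤ) :
    fourierCoeffOn hT.out f n =
      (1 / T) • ∫ x in (0 : ℝ)..T, fourier (-n) (x : AddCircle T) • f x := by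
  simp only [fourierCoeffOn_eq_integral, fourier_coe_apply, sub_zero]

theorem fourierCoeffOn_comp_coe (f : AddCircle T → E) (n : ℤ) :
    fourierCoeffOn hT.out (fun x : ℝ => f x) n = fourierCoeff f n := by
  rw [fourierCoeffOn_zero_left_eq_integral, fourierCoeff_eq_intervalIntegral f n 0, zero_add]

end FourierSeries

section TermwiseDifferentiation

open Filter Topology

variable {ι E : Type*} [NormedAddCommGroup E] [NormedSpace ℂ E] {F : ι → ℂ → E} {z : ℂ}

theorem exists_eventually_norm_deriv_le {M : ℝ}
    (hF : ∀ᶠ w in 𝓝 z, ∀ i, DifferentiableAt ℂ (F i) w ∧ ‖F i w‖ ≤ M) :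
    ∃ C, ∀ᶠ w in 𝓝 z, ∀ i, ‖deriv (F i) w‖ ≤ C := by
  obtain ⟨r, hr, hFr⟩ := Metric.eventually_nhds_iff_ball.mp hF
  refine ⟨M / (r / 2), Metric.eventually_nhds_iff_ball.mpr ⟨r / 2, half_pos hr, fun w hw i => ?_⟩⟩
  have hsub : Metric.closedBall w (r / 2) ⊆ Metric.ball z r :=
    Metric.closedBall_subset_ball' (by linarith [Metric.mem_ball.mp hw])
  have hdiff : DifferentiableOn ℂ (F i) (Metric.closedBall w (r / 2)) := fun x hx =>
    (hFr x (hsub hx) i).1.differentiableWithinAt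
  exact Complex.norm_deriv_le_of_forall_mem_sphere_norm_le (half_pos hr)
    (hdiff.diffContOnCl_ball subset_rfl) fun x hx =>
      (hFr x (hsub (Metric.sphere_subset_closedBall hx)) i).2

variable [CompleteSpace E] {u : ι → ℝ}

theorem differentiableAt_tsum_of_eventually_norm_le (hu : Summable u)
    (hF : ∀ᶠ w in 𝓝 z, ∀ i, DifferentiableAt ℂ (F i) w ∧ ‖F i w‖ ≤ u i) :
    DifferentiableAt ℂ (fun w => ∑' i, F i w) z := by
  obtain ⟨U, hFU, hU, hz⟩ := eventually_nhds_iff.mp hF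
  exact (Complex.differentiableOn_tsum_of_summable_norm hu
    (fun i w hw => (hFU w hw i).1.differentiableWithinAt) hU
    (fun i w hw => (hFU w hw i).2)).differentiableAt (hU.mem_nhds hz)

theorem hasSum_deriv_of_eventually_norm_le (hu : Summable u)
    (hF : ∀ᶠ w in 𝓝 z, ∀ i, DifferentiableAt ℂ (F i) w ∧ ‖F i w‖ ≤ u i) :
    HasSum (fun i => deriv (F i) z) (deriv (fun w => ∑' i, F i w) z) := by
  obtain ⟨U, hFU, hU, hz⟩ := eventually_nhds_iff.mp hF
  exact Complex.hasSum_deriv_of_summable_norm hu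
    (fun i w hw => (hFU w hw i).1.differentiableWithinAt) hU (fun i w hw => (hFU w hw i).2) hz

end TermwiseDifferentiation

section ComplexPowers

open Complex

theorem ofReal_mul_cpow {r : ℝ} (hr : 0 ≤ r) (x w : ℂ) :
    ((r : ℂ) * x) ^ w = (r : ℂ) ^ w * x ^ w := by
  rcases eq_or_ne w 0 with rfl | hw
  · simp
  rcases hr.eq_or_lt with rfl | hr
  · simp [hw]
  rcases eq_or_ne x 0 with rfl | hx
  · simp [hw]
  have hr0 : (r : ℂ) ≠ 0 := ofReal_ne_zero.mpr hr.ne'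
  rw [cpow_def_of_ne_zero (mul_ne_zero hr0 hx), cpow_def_of_ne_zero hr0, cpow_def_of_ne_zero hx,
    log_ofReal_mul hr hx, ofReal_log hr.le, add_mul, exp_add]

theorem two_pi_I_mul_natCast_cpow (n : ℕ) (w : ℂ) :
    (2 * Real.pi * I * n) ^ w = (2 * Real.pi) ^ w * n ^ w * exp (Real.pi * I * w / 2) := by
  have hI : I ^ w = exp (Real.pi * I * w / 2) := by
    rw [cpow_def_of_ne_zero I_ne_zero, log_I]
    ring_nf
  rw [show (2 * Real.pi * I * n : ℂ) = ((2 * Real.pi : ℝ) : ℂ) * ((n : ℝ) * I) by push_cast; ring,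
    ofReal_mul_cpow Real.two_pi_pos.le, ofReal_mul_cpow n.cast_nonneg, hI]
  push_cast
  ring

theorem two_pi_I_mul_neg_natCast_cpow (n : ℕ) (w : ℂ) :
    (2 * Real.pi * I * -n) ^ w = (2 * Real.pi) ^ w * n ^ w * exp (-(Real.pi * I * w / 2)) := by
  have hI : (-I) ^ w = exp (-(Real.pi * I * w / 2)) := by
    rw [cpow_def_of_ne_zero (neg_ne_zero.mpr I_ne_zero), log_neg_I]
    ring_nf
  rw [show (2 * Real.pi * I * -n : ℂ) = ((2 * Real.pi : ℝ) : ℂ) * ((n : ℝ) * -I) by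
      push_cast; ring,
    ofReal_mul_cpow Real.two_pi_pos.le, ofReal_mul_cpow n.cast_nonneg, hI]
  push_cast
  ring

end ComplexPowers

section HurwitzFourierSeries

open Complex HurwitzZeta Filter Topology

/-- The `n`-th Fourier coefficient `(2πin)⁻ˢ Γ(s)` of the periodised Hurwitz zeta function
`a ↦ ζ(1 - s, a)`, with the principal branch of the power. -/
noncomputable def hurwitzFourierCoeff (n : ℤ) (s : ℂ) : ℂ :=
  (2 * Real.pi * I * n) ^ (-s) * Gamma s

theorem differentiableAt_Gamma_of_re_pos {s : ℂ} (hs : 0 < s.re) : DifferentiableAt ℂ Gamma s := by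
  refine differentiableAt_Gamma s fun m hm => ?_
  rw [hm, neg_re, natCast_re] at hs
  linarith [m.cast_nonneg (α := ℝ)]

theorem hasDerivAt_hurwitzFourierCoeff (n : ℤ) {s : ℂ} (hs : 0 < s.re) :
    HasDerivAt (hurwitzFourierCoeff n)
      ((2 * Real.pi * I * n) ^ (-s) * (deriv Gamma s - Gamma s * log (2 * Real.pi * I * n))) s := by
  have hs0 : -s ≠ 0 := neg_ne_zero.mpr fun h => by simp [h] at hs
  have hpow := (hasDerivAt_neg s).const_cpow (c := 2 * Real.pi * I * n) (Or.inr hs0)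
  refine (hpow.mul (differentiableAt_Gamma_of_re_pos hs).hasDerivAt).congr_deriv ?_
  ring

theorem continuousAt_deriv_hurwitzFourierCoeff (n : ℤ) {s : ℂ} (hs : 0 < s.re) :
    ContinuousAt (deriv (hurwitzFourierCoeff n)) s := by
  have hopen : IsOpen {w : ℂ | 0 < w.re} := isOpen_lt continuous_const continuous_re
  have hdiff : DifferentiableOn ℂ (hurwitzFourierCoeff n) {w : ℂ | 0 < w.re} := fun w hw =>
    (hasDerivAt_hurwitzFourierCoeff n hw).differentiableAt.differentiableWithinAt
  exact ((hdiff.deriv hopen).differentiableAt (hopen.mem_nhds hs)).continuousAt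

theorem hasSum_hurwitzFourierCoeff_natCast {s : ℂ} (hs : 1 < s.re) (x : ℝ) :
    HasSum (fun n : ℕ => hurwitzFourierCoeff n s * fourier n (x : UnitAddCircle))
      ((2 * Real.pi) ^ (-s) * Gamma s * exp (-Real.pi * I * s / 2) * expZeta x s) := by
  refine ((hasSum_expZeta_of_one_lt_re x hs).mul_left _).congr_fun fun n => ?_
  rw [hurwitzFourierCoeff, Int.cast_natCast, two_pi_I_mul_natCast_cpow, cpow_neg (n : ℂ),
    fourier_coe_apply]
  push_cast
  ring_nf

theorem hasSum_hurwitzFourierCoeff_neg_natCast {s : ℂ} (hs : 1 < s.re) (x : ℝ) :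
    HasSum (fun n : ℕ => hurwitzFourierCoeff (-n) s * fourier (-n) (x : UnitAddCircle))
      ((2 * Real.pi) ^ (-s) * Gamma s * exp (Real.pi * I * s / 2) *
        expZeta (-x : UnitAddCircle) s) := by
  rw [← AddCircle.coe_neg]
  refine ((hasSum_expZeta_of_one_lt_re (-x) hs).mul_left _).congr_fun fun n => ?_
  rw [hurwitzFourierCoeff, Int.cast_neg, Int.cast_natCast, two_pi_I_mul_neg_natCast_cpow,
    cpow_neg (n : ℂ), fourier_coe_apply]
  push_cast
  ring_nf

theorem hasSum_hurwitzFourierCoeff {s : ℂ} (hs : 1 < s.re) (a : UnitAddCircle) :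
    HasSum (fun n : ℤ => hurwitzFourierCoeff n s * fourier n a) (hurwitzZeta a (1 - s)) := by
  induction a using QuotientAddGroup.induction_on with | H x => ?_
  have hs1 : s ≠ 1 := by rintro rfl; simp at hs
  have hs_neg (m : ℕ) : s ≠ -m := by
    rintro rfl
    rw [neg_re, natCast_re] at hs
    linarith [m.cast_nonneg (α := ℝ)]
  have hzero : hurwitzFourierCoeff 0 s = 0 := by
    have hs0 : s ≠ 0 := by simpa using hs_neg 0
    simp [hurwitzFourierCoeff, hs0]
  have hsum := HasSum.of_nat_of_neg
    (f := fun n : ℤ => hurwitzFourierCoeff n s * fourier n (x : UnitAddCircle))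
    (hasSum_hurwitzFourierCoeff_natCast hs x) (hasSum_hurwitzFourierCoeff_neg_natCast hs x)
  rw [hzero, zero_mul, sub_zero] at hsum
  rw [hurwitzZeta_one_sub _ hs_neg (Or.inr hs1)]
  convert! hsum using 1
  ring

theorem norm_two_pi_I_mul_intCast_cpow_neg_le (n : ℤ) {σ : ℝ} (hσ : 0 ≤ σ) {w : ℂ}
    (hw : σ < w.re) :
    ‖(2 * Real.pi * I * n) ^ (-w)‖ ≤ |(n : ℝ)| ^ (-σ) * Real.exp (Real.pi * |w.im|) := by
  have hw0 : -w ≠ 0 := neg_ne_zero.mpr fun h => by rw [h, zero_re] at hw; linarith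
  rcases eq_or_ne n 0 with rfl | hn
  · simp only [Int.cast_zero, mul_zero, zero_cpow hw0, norm_zero]
    positivity
  have hn1 : 1 ≤ |(n : ℝ)| := mod_cast Int.one_le_abs hn
  have hnorm : |(n : ℝ)| ≤ ‖2 * Real.pi * I * (n : ℂ)‖ := by
    simp only [norm_mul, norm_ofNat, norm_real, Real.norm_eq_abs, abs_of_pos Real.pi_pos, norm_I,
      mul_one, norm_intCast]
    exact le_mul_of_one_le_left (abs_nonneg _) (by linarith [Real.pi_gt_three])
  have hexp : -(Real.pi * |w.im|) ≤ (2 * Real.pi * I * (n : ℂ)).arg * (-w).im := by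
    refine (abs_le.mp ?_).1
    rw [abs_mul, neg_im, abs_neg]
    exact mul_le_mul_of_nonneg_right (abs_arg_le_pi _) (abs_nonneg _)
  calc ‖(2 * Real.pi * I * n) ^ (-w)‖
      ≤ ‖2 * Real.pi * I * (n : ℂ)‖ ^ (-w).re /
          Real.exp ((2 * Real.pi * I * (n : ℂ)).arg * (-w).im) := norm_cpow_le _ _
    _ ≤ |(n : ℝ)| ^ (-w).re / Real.exp (-(Real.pi * |w.im|)) := by
        gcongr ?_ / Real.exp ?_
        exact Real.rpow_le_rpow_of_nonpos (by linarith) hnorm (by rw [neg_re]; linarith)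
    _ ≤ |(n : ℝ)| ^ (-σ) * Real.exp (Real.pi * |w.im|) := by
        rw [Real.exp_neg, div_inv_eq_mul, neg_re]
        gcongr

theorem exists_summable_norm_hurwitzFourierCoeff_le {s : ℂ} (hs : 1 < s.re) :
    ∃ u : ℤ → ℝ, Summable u ∧ ∀ᶠ w in 𝓝 s, ∀ n, ‖hurwitzFourierCoeff n w‖ ≤ u n := by
  obtain ⟨σ, hσ1, hσs⟩ := exists_between hs
  have hcont : ContinuousAt (fun w : ℂ => Real.exp (Real.pi * |w.im|) * ‖Gamma w‖) s :=
    (by fun_prop : Continuous fun w : ℂ => Real.exp (Real.pi * |w.im|)).continuousAt.mul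
      (differentiableAt_Gamma_of_re_pos (zero_lt_one.trans hs)).continuousAt.norm
  obtain ⟨M, hM⟩ := exists_gt (Real.exp (Real.pi * |s.im|) * ‖Gamma s‖)
  refine ⟨fun n => |(n : ℝ)| ^ (-σ) * M, (Real.summable_abs_int_rpow hσ1).mul_right M, ?_⟩
  filter_upwards [hcont.eventually_lt_const hM,
    (isOpen_lt continuous_const continuous_re).mem_nhds hσs] with w hwM hσw n
  calc ‖hurwitzFourierCoeff n w‖
      ≤ |(n : ℝ)| ^ (-σ) * Real.exp (Real.pi * |w.im|) * ‖Gamma w‖ := by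
        rw [hurwitzFourierCoeff, norm_mul]
        gcongr
        exact norm_two_pi_I_mul_intCast_cpow_neg_le n (by linarith) hσw
    _ ≤ |(n : ℝ)| ^ (-σ) * M := by
        rw [mul_assoc]
        gcongr

theorem hasSum_deriv_hurwitzFourierCoeff {s : ℂ} (hs : 1 < s.re) (a : UnitAddCircle) :
    HasSum (fun n : ℤ => deriv (hurwitzFourierCoeff n) s * fourier n a)
      (-deriv (hurwitzZeta a) (1 - s)) := by
  obtain ⟨u, hu, hbound⟩ := exists_summable_norm_hurwitzFourierCoeff_le hs
  have hhalf : ∀ᶠ w : ℂ in 𝓝 s, 1 < w.re :=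
    (isOpen_lt continuous_const continuous_re).mem_nhds hs
  have hterm : ∀ᶠ w in 𝓝 s, ∀ n : ℤ,
      DifferentiableAt ℂ (fun w => hurwitzFourierCoeff n w * fourier n a) w ∧
        ‖hurwitzFourierCoeff n w * fourier n a‖ ≤ u n := by
    filter_upwards [hbound, hhalf] with w hw hw1 n
    refine ⟨(hasDerivAt_hurwitzFourierCoeff n
      (zero_lt_one.trans hw1)).differentiableAt.mul_const _, ?_⟩
    rw [norm_mul, fourier_apply, Circle.norm_coe, mul_one]
    exact hw n
  have hseries : (fun w => ∑' n : ℤ, hurwitzFourierCoeff n w * fourier n a) =ᶠ[𝓝 s]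
      fun w => hurwitzZeta a (1 - w) := by
    filter_upwards [hhalf] with w hw using (hasSum_hurwitzFourierCoeff hw a).tsum_eq
  have hderiv (n : ℤ) : deriv (fun w => hurwitzFourierCoeff n w * fourier n a) s =
      deriv (hurwitzFourierCoeff n) s * fourier n a := by
    simp only [deriv_mul_const_field]
  rw [← deriv_comp_const_sub, ← hseries.deriv_eq]
  simpa only [hderiv] using hasSum_deriv_of_eventually_norm_le hu hterm

theorem hasSum_neg_deriv_hurwitzFourierCoeff {s : ℂ} (hs : 1 < s.re) (a : UnitAddCircle) :
    HasSum (fun n : ℤ => -deriv (hurwitzFourierCoeff n) s * fourier n a)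
      (deriv (hurwitzZeta a) (1 - s)) := by
  simpa only [neg_mul, neg_neg] using (hasSum_deriv_hurwitzFourierCoeff hs a).neg

theorem summable_neg_deriv_hurwitzFourierCoeff {s : ℂ} (hs : 1 < s.re) :
    Summable fun n : ℤ => -deriv (hurwitzFourierCoeff n) s := by
  simpa using (hasSum_neg_deriv_hurwitzFourierCoeff hs 0).summable

theorem continuous_deriv_hurwitzZeta_one_sub {s : ℂ} (hs : 1 < s.re) :
    Continuous fun a : UnitAddCircle => deriv (hurwitzZeta a) (1 - s) :=
  continuous_of_hasSum_fourier (summable_neg_deriv_hurwitzFourierCoeff hs)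
    (hasSum_neg_deriv_hurwitzFourierCoeff hs)

theorem fourierCoeff_deriv_hurwitzZeta_one_sub {s : ℂ} (hs : 1 < s.re) (n : ℤ) :
    fourierCoeff (fun a : UnitAddCircle => deriv (hurwitzZeta a) (1 - s)) n =
      -deriv (hurwitzFourierCoeff n) s :=
  fourierCoeff_of_hasSum_fourier (summable_neg_deriv_hurwitzFourierCoeff hs)
    (hasSum_neg_deriv_hurwitzFourierCoeff hs) n

theorem deriv_hurwitzFourierCoeff_natCast_add_one (n : ℤ) (k : ℕ) :
    deriv (hurwitzFourierCoeff n) (k + 1) = k.factorial *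
      (harmonic k - Real.eulerMascheroniConstant - log (2 * Real.pi * I * n)) /
        (2 * Real.pi * I * n) ^ (k + 1) := by
  have hre : 0 < ((k : ℂ) + 1).re := by
    rw [add_re, natCast_re, one_re]
    positivity
  rw [(hasDerivAt_hurwitzFourierCoeff n hre).deriv, Gamma_nat_eq_factorial, deriv_Gamma_nat,
    cpow_neg, ← Nat.cast_add_one, cpow_natCast]
  ring

end HurwitzFourierSeries

section LinearInterpolation

open Set Metric

variable {E : Type*} [NormedAddCommGroup E] [NormedSpace ℝ E]

theorem norm_sub_lineMap_le_of_norm_deriv2_le {f f' f'' : ℝ → E} {a b C q : ℝ} (hab : a ≤ b)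
    (hf : ∀ t ∈ Icc a b, HasDerivWithinAt f (f' t) (Icc a b) t)
    (hf' : ∀ t ∈ Icc a b, HasDerivWithinAt f' (f'' t) (Icc a b) t)
    (hC : ∀ t ∈ Icc a b, ‖f'' t‖ ≤ C) (hq : q ∈ Icc 0 1) :
    ‖f (AffineMap.lineMap a b q) - AffineMap.lineMap (f a) (f b) q‖ ≤ C * (b - a) ^ 2 := by
  have ha : a ∈ Icc a b := left_mem_Icc.mpr hab
  have hb : b ∈ Icc a b := right_mem_Icc.mpr hab
  have hC0 : 0 ≤ C := (norm_nonneg _).trans (hC a ha)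
  have norm_sub_le {x y : ℝ} (hx : x ∈ Icc a b) (hy : y ∈ Icc a b) : ‖x - y‖ ≤ b - a := by
    simpa only [dist_eq_norm] using Real.dist_le_of_mem_Icc hx hy
  -- Subtracting the tangent at `a` does not change the interpolation error.
  let g (t : ℝ) : E := f t - (t - a) • f' a
  have hg : ∀ t ∈ Icc a b, HasDerivWithinAt g (f' t - f' a) (Icc a b) t := fun t ht => by
    simpa only [g, one_smul] using!
      (hf t ht).sub (((hasDerivWithinAt_id t _).sub_const a).smul_const (f' a))
  have hg_bound : ∀ t ∈ Icc a b, ‖f' t - f' a‖ ≤ C * (b - a) := fun t ht =>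
    ((convex_Icc a b).norm_image_sub_le_of_norm_hasDerivWithin_le hf' hC ha ht).trans
      (by gcongr; exact norm_sub_le ht ha)
  have hg_sub {x y : ℝ} (hx : x ∈ Icc a b) (hy : y ∈ Icc a b) :
      ‖g x - g y‖ ≤ C * (b - a) * (b - a) :=
    ((convex_Icc a b).norm_image_sub_le_of_norm_hasDerivWithin_le hg hg_bound hy hx).trans <| by
      have := norm_sub_le hx hy
      have := sub_nonneg.mpr hab
      gcongr
  have hx : AffineMap.lineMap a b q ∈ Icc a b := (convex_Icc a b).lineMap_mem ha hb hq
  have error_eq : f (AffineMap.lineMap a b q) - AffineMap.lineMap (f a) (f b) q =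
      g (AffineMap.lineMap a b q) - AffineMap.lineMap (g a) (g b) q := by
    simp only [g, AffineMap.lineMap_apply_module, smul_eq_mul]
    module
  rw [error_eq, sq, ← mul_assoc, ← mem_closedBall_iff_norm']
  exact (convex_closedBall _ _).lineMap_mem (mem_closedBall_iff_norm'.mpr (hg_sub hx ha))
    (mem_closedBall_iff_norm'.mpr (hg_sub hx hb)) hq

end LinearInterpolation

section ContinuationByInterpolation

open Complex HurwitzZeta Filter Topology Set

/-- The deviation of `t ↦ t⁻ᶻ` at `n + 1 + q` from its linear interpolation between `n + 1` and
`n + 2`. These deviations are summable for `-1 < re z`, which continues `ζ(z, q) - ζ(z)` beyond the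
half plane of convergence of the two series. -/
noncomputable def cpowInterpError (q : ℝ) (n : ℕ) (z : ℂ) : ℂ :=
  ((n + 1 + q : ℝ) : ℂ) ^ (-z) -
    ((1 - q) * ((n + 1 : ℝ) : ℂ) ^ (-z) + q * ((n + 2 : ℝ) : ℂ) ^ (-z))

theorem hasDerivAt_ofReal_cpow_of_pos (w : ℂ) {t : ℝ} (ht : 0 < t) :
    HasDerivAt (fun t : ℝ => (t : ℂ) ^ w) (w * (t : ℂ) ^ (w - 1)) t := by
  simpa using
    ((hasDerivAt_id (t : ℂ)).cpow_const (c := w) (ofReal_mem_slitPlane.mpr ht)).comp_ofReal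

theorem hasDerivAt_ofReal_cpow_neg {c : ℝ} (hc : 0 < c) (z : ℂ) :
    HasDerivAt (fun z : ℂ => (c : ℂ) ^ (-z)) (-(Real.log c * (c : ℂ) ^ (-z))) z := by
  refine ((hasDerivAt_neg z).const_cpow (Or.inl (ofReal_ne_zero.mpr hc.ne'))).congr_deriv ?_
  rw [ofReal_log hc.le]
  ring

theorem norm_cpowInterpError_le {q : ℝ} (hq : q ∈ Icc 0 1) (n : ℕ) {z : ℂ} (hz : -2 ≤ z.re) :
    ‖cpowInterpError q n z‖ ≤ ‖z‖ * ‖z + 1‖ * (n + 1 : ℝ) ^ (-z.re - 2) := by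
  have hn : (0 : ℝ) < n + 1 := n.cast_add_one_pos
  have hpos : ∀ t ∈ Icc (n + 1 : ℝ) (n + 2), 0 < t := fun t ht => hn.trans_le ht.1
  have hderiv2 : ∀ t ∈ Icc (n + 1 : ℝ) (n + 2),
      ‖-z * ((-z - 1) * (t : ℂ) ^ (-z - 1 - 1))‖ ≤ ‖z‖ * ‖z + 1‖ * (n + 1 : ℝ) ^ (-z.re - 2) := by
    intro t ht
    have hexp : (-z - 1 - 1).re = -z.re - 2 := by
      simp only [sub_re, neg_re, one_re]
      ring
    rw [norm_mul, norm_mul, norm_cpow_eq_rpow_re_of_pos (hpos t ht), hexp, norm_neg,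
      ← neg_add', norm_neg, ← mul_assoc]
    gcongr ‖z‖ * ‖z + 1‖ * ?_
    exact Real.rpow_le_rpow_of_nonpos hn ht.1 (by linarith)
  have interp := norm_sub_lineMap_le_of_norm_deriv2_le (by linarith)
    (fun t ht => (hasDerivAt_ofReal_cpow_of_pos (-z) (hpos t ht)).hasDerivWithinAt)
    (fun t ht => ((hasDerivAt_ofReal_cpow_of_pos (-z - 1) (hpos t ht)).const_mul
      (-z)).hasDerivWithinAt) hderiv2 hq
  have hpoint : AffineMap.lineMap (n + 1 : ℝ) (n + 2) q = n + 1 + q := by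
    rw [AffineMap.lineMap_apply_ring']
    ring
  have hgap : (n + 2 : ℝ) - (n + 1) = 1 := by ring
  simpa only [cpowInterpError, hpoint, hgap, AffineMap.lineMap_apply_module, real_smul, ofReal_sub,
    ofReal_one, one_pow, mul_one] using interp

theorem exists_summable_norm_cpowInterpError_le {z : ℂ} (hz : -1 < z.re) :
    ∃ u : ℕ → ℝ, Summable u ∧
      ∀ᶠ w in 𝓝 z, ∀ q : Icc (0 : ℝ) 1, ∀ n, ‖cpowInterpError q n w‖ ≤ u n := by
  obtain ⟨σ, hσ1, hσz⟩ := exists_between hz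
  obtain ⟨M, hM⟩ := exists_gt (‖z‖ * ‖z + 1‖)
  have hM0 : 0 ≤ M := (by positivity : 0 ≤ ‖z‖ * ‖z + 1‖).trans hM.le
  have hcont : ContinuousAt (fun w : ℂ => ‖w‖ * ‖w + 1‖) z := by fun_prop
  have hsummable : Summable fun n : ℕ => (n + 1 : ℝ) ^ (-σ - 2) := by
    simpa using (summable_nat_add_iff 1).mpr
      (Real.summable_nat_rpow.mpr (by linarith : -σ - 2 < -1))
  refine ⟨fun n => M * (n + 1 : ℝ) ^ (-σ - 2), hsummable.mul_left M, ?_⟩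
  filter_upwards [hcont.eventually_lt_const hM,
    continuous_re.continuousAt.eventually_const_lt hσz] with w hwM hσw q n
  have hn : (1 : ℝ) ≤ n + 1 := by linarith [n.cast_nonneg (α := ℝ)]
  refine (norm_cpowInterpError_le q.2 n (by linarith)).trans ?_
  gcongr

theorem hasDerivAt_cpowInterpError {q : ℝ} (hq : 0 ≤ q) (n : ℕ) (z : ℂ) :
    HasDerivAt (cpowInterpError q n)
      (-(Real.log (n + 1 + q) * ((n + 1 + q : ℝ) : ℂ) ^ (-z)) -
        ((1 - q) * -(Real.log (n + 1) * ((n + 1 : ℝ) : ℂ) ^ (-z)) +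
          q * -(Real.log (n + 2) * ((n + 2 : ℝ) : ℂ) ^ (-z)))) z :=
  (hasDerivAt_ofReal_cpow_neg (by positivity) z).sub
    (((hasDerivAt_ofReal_cpow_neg (by positivity) z).const_mul _).add
      ((hasDerivAt_ofReal_cpow_neg (by positivity) z).const_mul _))

theorem exists_summable_differentiableAt_cpowInterpError {z : ℂ} (hz : -1 < z.re) :
    ∃ u : ℕ → ℝ, Summable u ∧ ∀ᶠ w in 𝓝 z, ∀ q : Icc (0 : ℝ) 1, ∀ n,
      DifferentiableAt ℂ (cpowInterpError q n) w ∧ ‖cpowInterpError q n w‖ ≤ u n := by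
  obtain ⟨u, hu, hbound⟩ := exists_summable_norm_cpowInterpError_le hz
  exact ⟨u, hu, hbound.mono fun w hw q n =>
    ⟨(hasDerivAt_cpowInterpError q.2.1 n w).differentiableAt, hw q n⟩⟩

theorem differentiableAt_tsum_cpowInterpError {q : ℝ} (hq : q ∈ Icc 0 1) {z : ℂ}
    (hz : -1 < z.re) : DifferentiableAt ℂ (fun w => ∑' n, cpowInterpError q n w) z := by
  obtain ⟨u, hu, hbound⟩ := exists_summable_differentiableAt_cpowInterpError hz
  exact differentiableAt_tsum_of_eventually_norm_le hu (hbound.mono fun w hw => hw ⟨q, hq⟩)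

theorem hasSum_deriv_cpowInterpError {q : ℝ} (hq : q ∈ Icc 0 1) {z : ℂ} (hz : -1 < z.re) :
    HasSum (fun n => deriv (cpowInterpError q n) z)
      (deriv (fun w => ∑' n, cpowInterpError q n w) z) := by
  obtain ⟨u, hu, hbound⟩ := exists_summable_differentiableAt_cpowInterpError hz
  exact hasSum_deriv_of_eventually_norm_le hu (hbound.mono fun w hw => hw ⟨q, hq⟩)

theorem exists_eventually_norm_deriv_tsum_cpowInterpError_le {z : ℂ} (hz : -1 < z.re) :
    ∃ C, ∀ᶠ w in 𝓝 z, ∀ q : Icc (0 : ℝ) 1,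
      ‖deriv (fun w => ∑' n, cpowInterpError q n w) w‖ ≤ C := by
  obtain ⟨u, hu, hbound⟩ := exists_summable_differentiableAt_cpowInterpError hz
  refine exists_eventually_norm_deriv_le (M := ∑' n, u n) ?_
  filter_upwards [hbound, (isOpen_lt continuous_const continuous_re).mem_nhds hz] with w hw hre q
  exact ⟨differentiableAt_tsum_cpowInterpError q.2 hre,
    tsum_of_norm_bounded hu.hasSum fun n => (hw q n).2⟩

theorem hasSum_cpowInterpError {q : ℝ} (hq : q ∈ Icc 0 1) {z : ℂ} (hz : 1 < z.re) :
    HasSum (fun n => cpowInterpError q n z)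
      (hurwitzZeta (q : UnitAddCircle) z - riemannZeta z - (q : ℂ) ^ (-z) + q) := by
  have hz0 : z ≠ 0 := by rintro rfl; norm_num at hz
  have hhurwitz := (hasSum_nat_add_iff' 1).mpr (hasSum_hurwitzZeta_of_one_lt_re hq hz)
  have hriemann := hasSum_hurwitzZeta_of_one_lt_re (left_mem_Icc.mpr zero_le_one) hz
  rw [AddCircle.coe_zero, hurwitzZeta_zero] at hriemann
  have hsum := hhurwitz.sub ((((hasSum_nat_add_iff' 1).mpr hriemann).mul_left (1 - (q : ℂ))).add
    (((hasSum_nat_add_iff' 2).mpr hriemann).mul_left (q : ℂ)))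
  convert! hsum using 1
  · funext n
    simp only [cpowInterpError, cpow_neg, one_div]
    push_cast
    ring_nf
  · simp [Finset.sum_range_succ, hz0, cpow_neg]
    ring

theorem eqOn_hurwitzZeta_sub_riemannZeta {q : ℝ} (hq0 : 0 < q) (hq1 : q ≤ 1) :
    EqOn (fun z => hurwitzZeta (q : UnitAddCircle) z - riemannZeta z)
      (fun z => (q : ℂ) ^ (-z) - q + ∑' n, cpowInterpError q n z) {z | -1 < z.re} := by
  have hopen : IsOpen {z : ℂ | -1 < z.re} := isOpen_lt continuous_const continuous_re
  have hleft : AnalyticOnNhd ℂ (fun z => hurwitzZeta (q : UnitAddCircle) z - riemannZeta z)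
      {z | -1 < z.re} := by
    have := differentiable_hurwitzZeta_sub_hurwitzZeta (q : UnitAddCircle) 0
    rw [hurwitzZeta_zero] at this
    exact this.differentiableOn.analyticOnNhd hopen
  have hright : AnalyticOnNhd ℂ (fun z => (q : ℂ) ^ (-z) - q + ∑' n, cpowInterpError q n z)
      {z | -1 < z.re} :=
    DifferentiableOn.analyticOnNhd (fun w hw =>
      (((hasDerivAt_ofReal_cpow_neg hq0 w).differentiableAt.sub_const _).add
        (differentiableAt_tsum_cpowInterpError ⟨hq0.le, hq1⟩ hw)).differentiableWithinAt) hopen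
  refine hleft.eqOn_of_preconnected_of_eventuallyEq hright
    (convex_halfSpace_re_gt (-1)).isPreconnected (z₀ := 2) (by norm_num) ?_
  filter_upwards [(isOpen_lt continuous_const continuous_re).mem_nhds
    (show (1 : ℝ) < (2 : ℂ).re by norm_num)] with w hw
  rw [(hasSum_cpowInterpError ⟨hq0.le, hq1⟩ hw).tsum_eq]
  ring

theorem deriv_hurwitzZeta_eq_add_deriv_tsum {q : ℝ} (hq0 : 0 < q) (hq1 : q ≤ 1) {z : ℂ}
    (hz : -1 < z.re) (hz1 : z ≠ 1) :
    deriv (hurwitzZeta (q : UnitAddCircle)) z =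
      deriv riemannZeta z - Real.log q * (q : ℂ) ^ (-z) +
        deriv (fun w => ∑' n, cpowInterpError q n w) z := by
  have hsum := ((differentiableAt_riemannZeta hz1).hasDerivAt.add
    ((hasDerivAt_ofReal_cpow_neg hq0 z).sub_const (q : ℂ))).add
      (differentiableAt_tsum_cpowInterpError ⟨hq0.le, hq1⟩ hz).hasDerivAt
  refine ((hsum.congr_of_eventuallyEq ?_).congr_deriv (by ring)).deriv
  filter_upwards [(isOpen_lt continuous_const continuous_re).mem_nhds hz] with w hw
  have := eqOn_hurwitzZeta_sub_riemannZeta hq0 hq1 hw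
  simp only [Pi.add_apply]
  linear_combination this

end ContinuationByInterpolation

section LerchFormula

open Complex HurwitzZeta Filter Topology Set

theorem sum_range_log_interp_eq_logGammaSeq (q : ℝ) (N : ℕ) :
    ∑ n ∈ Finset.range N,
        ((1 - q) * Real.log (n + 1) + q * Real.log (n + 2) - Real.log (n + 1 + q)) =
      Real.BohrMollerup.logGammaSeq q N + Real.log q + q * (Real.log (N + 1) - Real.log N) := by
  have log_factorial : Real.log (N.factorial : ℝ) = ∑ n ∈ Finset.range N, Real.log (n + 1) := by
    rw [← Finset.prod_range_add_one_eq_factorial, Nat.cast_prod,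
      Real.log_prod fun i _ => Nat.cast_ne_zero.mpr i.succ_ne_zero]
    simp only [Nat.cast_add, Nat.cast_one]
  have log_succ : Real.log (N + 1) =
      ∑ n ∈ Finset.range N, (Real.log (n + 2) - Real.log (n + 1)) := by
    have telescope := Finset.sum_range_sub (fun n : ℕ => Real.log (n + 1)) N
    simp only [Nat.cast_add, Nat.cast_one, add_assoc, one_add_one_eq_two, Nat.cast_zero, zero_add,
      Real.log_one, sub_zero] at telescope
    exact telescope.symm
  rw [Real.BohrMollerup.logGammaSeq, Finset.sum_range_succ', log_factorial, log_succ,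
    Nat.cast_zero, add_zero, mul_sub, Finset.mul_sum]
  have summand (n : ℕ) : (1 - q) * Real.log (n + 1) + q * Real.log (n + 2) -
      Real.log (n + 1 + q) = Real.log (n + 1) + q * (Real.log (n + 2) - Real.log (n + 1)) -
        Real.log (q + (n + 1 : ℕ)) := by
    push_cast
    ring_nf
  simp only [summand, Finset.sum_sub_distrib, Finset.sum_add_distrib]
  ring

theorem tendsto_sum_range_log_interp {q : ℝ} (hq : 0 < q) :
    Tendsto (fun N : ℕ => ∑ n ∈ Finset.range N,
        ((1 - q) * Real.log (n + 1) + q * Real.log (n + 2) - Real.log (n + 1 + q))) atTop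
      (𝓝 (Real.log (Real.Gamma q) + Real.log q)) := by
  simpa only [sum_range_log_interp_eq_logGammaSeq, mul_zero, add_zero] using
    ((Real.BohrMollerup.tendsto_log_gamma hq).add_const (Real.log q)).add
      (Real.tendsto_log_nat_add_one_sub_log.const_mul q)

theorem deriv_cpowInterpError_zero {q : ℝ} (hq : 0 ≤ q) (n : ℕ) :
    deriv (cpowInterpError q n) 0 =
      (((1 - q) * Real.log (n + 1) + q * Real.log (n + 2) - Real.log (n + 1 + q) : ℝ) : ℂ) := by
  rw [(hasDerivAt_cpowInterpError hq n 0).deriv]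
  simp only [neg_zero, cpow_zero, mul_one]
  push_cast
  ring

theorem deriv_hurwitzZeta_zero {q : ℝ} (hq0 : 0 < q) (hq1 : q ≤ 1) :
    deriv (hurwitzZeta (q : UnitAddCircle)) 0 =
      ((Real.log (Real.Gamma q) - Real.log √(2 * Real.pi) : ℝ) : ℂ) := by
  have hre : -1 < (0 : ℂ).re := by norm_num
  have partial_sums := (hasSum_deriv_cpowInterpError ⟨hq0.le, hq1⟩ hre).tendsto_sum_nat
  simp only [deriv_cpowInterpError_zero hq0.le, ← ofReal_sum] at partial_sums
  have deriv_tsum := tendsto_nhds_unique partial_sums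
    ((continuous_ofReal.tendsto _).comp (tendsto_sum_range_log_interp hq0))
  have log_two_pi : log (2 * (Real.pi : ℂ)) = (Real.log (2 * Real.pi) : ℂ) := by
    rw [ofReal_log Real.two_pi_pos.le, ofReal_mul, ofReal_ofNat]
  rw [deriv_hurwitzZeta_eq_add_deriv_tsum hq0 hq1 hre zero_ne_one, deriv_tsum,
    deriv_riemannZeta_zero, log_two_pi, neg_zero, cpow_zero, Real.log_sqrt Real.two_pi_pos.le]
  push_cast
  ring

end LerchFormula

section DerivativeNearZero

open Complex HurwitzZeta Filter Topology Set MeasureTheory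

theorem abs_log_le_rpow {x t : ℝ} (hx0 : 0 < x) (hx1 : x ≤ 1) (ht : 0 < t) :
    |Real.log x| ≤ 1 / t * x ^ (-t) := by
  rw [Real.rpow_neg hx0.le, ← div_eq_mul_inv, le_div_iff₀ (Real.rpow_pos_of_pos hx0 t)]
  simpa only [abs_mul, abs_of_pos (Real.rpow_pos_of_pos hx0 t)] using
    (Real.abs_log_mul_self_rpow_lt x t hx0 hx1 ht).le

theorem memLp_log_restrict_Ioc {p : ENNReal} (hp : p ≠ ⊤) :
    MemLp Real.log p (volume.restrict (Ioc 0 1)) := by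
  lift p to NNReal using hp
  set t : ℝ := 1 / (2 * (p + 1)) with ht
  have ht0 : 0 < t := by positivity
  have memLp_rpow : MemLp (fun x : ℝ => x ^ (-t)) ↑(p + 1) (volume.restrict (Ioc 0 1)) := by
    rw [← integrable_norm_rpow_iff (by fun_prop) (by simp) ENNReal.coe_ne_top]
    have hint : IntegrableOn (fun x : ℝ => x ^ (-(1 / 2) : ℝ)) (Ioc 0 1) :=
      (intervalIntegral.intervalIntegrable_rpow' (by norm_num)).1
    refine hint.congr_fun (fun x hx => ?_) measurableSet_Ioc
    dsimp only
    rw [Real.norm_of_nonneg (Real.rpow_nonneg hx.1.le _), ← Real.rpow_mul hx.1.le, ht,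
      ENNReal.coe_toReal, NNReal.coe_add, NNReal.coe_one]
    congr 1
    field_simp
  refine ((memLp_rpow.const_mul (1 / t)).mono' (by fun_prop) ?_).mono_exponent
    (ENNReal.coe_le_coe.mpr le_self_add)
  exact ae_restrict_of_forall_mem measurableSet_Ioc fun x hx => abs_log_le_rpow hx.1 hx.2 ht0

theorem continuousAt_deriv_hurwitzZeta (a : UnitAddCircle) {z : ℂ} (hz : z ≠ 1) :
    ContinuousAt (deriv (hurwitzZeta a)) z := by
  have hdiff : DifferentiableOn ℂ (hurwitzZeta a) {1}ᶜ := fun w hw =>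
    (differentiableAt_hurwitzZeta a hw).differentiableWithinAt
  exact ((hdiff.deriv isOpen_compl_singleton).differentiableAt
    (isOpen_compl_singleton.mem_nhds hz)).continuousAt

theorem exists_eventually_norm_deriv_hurwitzZeta_le :
    ∃ C : ℝ, ∀ᶠ z : ℂ in 𝓝 0, z.re ≤ 0 → ∀ q ∈ Ioc (0 : ℝ) 1,
      ‖deriv (hurwitzZeta (q : UnitAddCircle)) z‖ ≤ C + |Real.log q| := by
  have hre : -1 < (0 : ℂ).re := by norm_num
  obtain ⟨C, hC⟩ := exists_eventually_norm_deriv_tsum_cpowInterpError_le hre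
  obtain ⟨M, hM⟩ := exists_gt ‖deriv (hurwitzZeta 0) 0‖
  refine ⟨M + C, ?_⟩
  filter_upwards [hC, (continuousAt_deriv_hurwitzZeta 0 zero_ne_one).norm.eventually_lt_const hM,
    continuous_re.continuousAt.eventually_const_lt hre] with z hCz hMz hz hz0 q hq
  rw [hurwitzZeta_zero] at hMz
  have hz1 : z ≠ 1 := by
    rintro rfl
    norm_num at hz0
  have hlog : ‖(Real.log q : ℂ) * (q : ℂ) ^ (-z)‖ ≤ |Real.log q| := by
    rw [norm_mul, norm_cpow_eq_rpow_re_of_pos hq.1, norm_real, Real.norm_eq_abs, neg_re]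
    exact mul_le_of_le_one_right (abs_nonneg _)
      (Real.rpow_le_one hq.1.le hq.2 (neg_nonneg.mpr hz0))
  rw [deriv_hurwitzZeta_eq_add_deriv_tsum hq.1 hq.2 hz hz1]
  calc ‖deriv riemannZeta z - Real.log q * (q : ℂ) ^ (-z) +
        deriv (fun w => ∑' n, cpowInterpError q n w) z‖
      ≤ M + |Real.log q| + C :=
        norm_add_le_of_le (norm_sub_le_of_le hMz.le hlog) (hCz ⟨q, hq.1.le, hq.2⟩)
    _ = M + C + |Real.log q| := by ring

theorem memLp_deriv_hurwitzZeta_zero {p : ENNReal} (hp : p ≠ ⊤) :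
    MemLp (fun q : ℝ => deriv (hurwitzZeta (q : UnitAddCircle)) 0) p
      (volume.restrict (Ioc 0 1)) := by
  obtain ⟨C, hC⟩ := exists_eventually_norm_deriv_hurwitzZeta_le
  have lerch : (fun q : ℝ => deriv (hurwitzZeta (q : UnitAddCircle)) 0)
      =ᵐ[volume.restrict (Ioc 0 1)]
        fun q => ((Real.log (Real.Gamma q) - Real.log √(2 * Real.pi) : ℝ) : ℂ) :=
    ae_restrict_of_forall_mem measurableSet_Ioc fun q hq => deriv_hurwitzZeta_zero hq.1 hq.2
  have hcont : ContinuousOn (fun q => ((Real.log (Real.Gamma q) - Real.log √(2 * Real.pi) : ℝ) : ℂ))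
      (Ioc 0 1) := by
    refine continuous_ofReal.comp_continuousOn (ContinuousOn.sub ?_ continuousOn_const)
    refine ContinuousOn.log (fun q hq => ?_) fun q hq => (Real.Gamma_pos_of_pos hq.1).ne'
    exact (Real.differentiableOn_Gamma_Ioi.continuousOn q hq.1).mono Ioc_subset_Ioi_self
  refine ((memLp_const C).add (memLp_log_restrict_Ioc hp).norm).mono
    ((hcont.aestronglyMeasurable measurableSet_Ioc).congr lerch.symm) ?_
  refine ae_restrict_of_forall_mem measurableSet_Ioc fun q hq => ?_
  exact (hC.self_of_nhds le_rfl q hq).trans (le_abs_self _)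

end DerivativeNearZero

section CoefficientsAtIntegers

open HurwitzZeta Filter Topology MeasureTheory Set

theorem memLp_restrict_Ioc_of_continuous {E : Type*} [NormedAddCommGroup E] {f : ℝ → E}
    (hf : Continuous f) (a b : ℝ) (p : ENNReal) : MemLp f p (volume.restrict (Ioc a b)) := by
  obtain ⟨C, hC⟩ := isCompact_Icc.exists_bound_of_continuousOn (s := Icc a b) hf.continuousOn
  exact MemLp.of_bound hf.aestronglyMeasurable.restrict C
    (ae_restrict_of_forall_mem measurableSet_Ioc fun x hx => hC x (Ioc_subset_Icc_self hx))

theorem tendsto_fourierCoeffOn_deriv_hurwitzZeta_zero (n : ℤ) :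
    Tendsto (fun z : ℂ => fourierCoeffOn (zero_lt_one' ℝ)
        (fun q : ℝ => deriv (hurwitzZeta (q : UnitAddCircle)) z) n) (𝓝[{z | z.re < 0}] 0)
      (𝓝 (fourierCoeffOn (zero_lt_one' ℝ)
        (fun q : ℝ => deriv (hurwitzZeta (q : UnitAddCircle)) 0) n)) := by
  obtain ⟨C, hC⟩ := exists_eventually_norm_deriv_hurwitzZeta_le
  simp only [fourierCoeffOn_zero_left_eq_integral]
  refine (intervalIntegral.tendsto_integral_filter_of_dominated_convergence
    (fun q => C + |Real.log q|) ?_ ?_ ?_ ?_).const_smul _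
  · filter_upwards [self_mem_nhdsWithin] with z hz
    have hcont : Continuous fun a : UnitAddCircle => deriv (hurwitzZeta a) z := by
      have hs : 1 < (1 - z).re := by simpa [lt_sub_iff_add_lt] using hz
      simpa only [sub_sub_cancel] using continuous_deriv_hurwitzZeta_one_sub hs
    exact (((map_continuous (fourier (-n))).smul hcont).comp
      (AddCircle.continuous_mk' 1)).aestronglyMeasurable
  · filter_upwards [self_mem_nhdsWithin, nhdsWithin_le_nhds hC] with z hz hCz
    refine Eventually.of_forall fun q hq => ?_
    rw [uIoc_of_le zero_le_one] at hq
    rw [norm_smul, fourier_apply, Circle.norm_coe, one_mul]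
    exact hCz (le_of_lt hz) q hq
  · exact (intervalIntegrable_const (μ := volume)).add
      intervalIntegral.intervalIntegrable_log'.norm
  · refine Eventually.of_forall fun q _ => Tendsto.const_smul ?_ _
    exact (continuousAt_deriv_hurwitzZeta (q : UnitAddCircle) zero_ne_one).mono_left
      nhdsWithin_le_nhds

theorem fourierCoeffOn_deriv_hurwitzZeta_zero (n : ℤ) :
    fourierCoeffOn (zero_lt_one' ℝ)
        (fun q : ℝ => deriv (hurwitzZeta (q : UnitAddCircle)) 0) n =
      -deriv (hurwitzFourierCoeff n) 1 := by
  have : (𝓝[{z : ℂ | z.re < 0}] 0).NeBot := by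
    rw [← mem_closure_iff_nhdsWithin_neBot, Complex.closure_setOfPred_re_lt]
    exact le_refl (0 : ℝ)
  have coeff_limit : Tendsto (fun z : ℂ => -deriv (hurwitzFourierCoeff n) (1 - z))
      (𝓝[{z | z.re < 0}] 0) (𝓝 (-deriv (hurwitzFourierCoeff n) 1)) := by
    have hcont := continuousAt_deriv_hurwitzFourierCoeff n (s := 1) (by simp)
    refine (hcont.tendsto.comp ?_).neg.mono_left nhdsWithin_le_nhds
    exact (continuous_const.sub continuous_id).tendsto' 0 1 (sub_zero 1)
  refine tendsto_nhds_unique (tendsto_fourierCoeffOn_deriv_hurwitzZeta_zero n)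
    (coeff_limit.congr' ?_)
  filter_upwards [self_mem_nhdsWithin] with z hz
  have hs : 1 < (1 - z).re := by simpa [lt_sub_iff_add_lt] using hz
  simpa only [sub_sub_cancel] using
    ((fourierCoeffOn_comp_coe _ n).trans (fourierCoeff_deriv_hurwitzZeta_one_sub hs n)).symm

theorem memLp_deriv_hurwitzZeta_neg_natCast (k : ℕ) {p : ENNReal} (hp : p ≠ ⊤) :
    MemLp (fun q : ℝ => deriv (hurwitzZeta (q : UnitAddCircle)) (-k)) p
      (volume.restrict (Ioc 0 1)) := by
  rcases k.eq_zero_or_pos with rfl | hk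
  · simpa only [Nat.cast_zero, neg_zero] using memLp_deriv_hurwitzZeta_zero hp
  · have hcont : Continuous fun a : UnitAddCircle => deriv (hurwitzZeta a) (-k) := by
      have hs : 1 < (1 + k : ℂ).re := by simpa using hk
      simpa only [sub_add_cancel_left] using continuous_deriv_hurwitzZeta_one_sub hs
    exact memLp_restrict_Ioc_of_continuous (hcont.comp (AddCircle.continuous_mk' 1)) 0 1 p

theorem fourierCoeffOn_deriv_hurwitzZeta_neg_natCast (k : ℕ) (n : ℤ) :
    fourierCoeffOn (zero_lt_one' ℝ)
        (fun q : ℝ => deriv (hurwitzZeta (q : UnitAddCircle)) (-k)) n =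
      -deriv (hurwitzFourierCoeff n) (k + 1) := by
  rcases k.eq_zero_or_pos with rfl | hk
  · simpa only [Nat.cast_zero, neg_zero, zero_add] using fourierCoeffOn_deriv_hurwitzZeta_zero n
  · have hs : 1 < (k + 1 : ℂ).re := by simpa using hk
    rw [← fourierCoeff_deriv_hurwitzZeta_one_sub hs, sub_add_cancel_right]
    exact fourierCoeffOn_comp_coe (fun a => deriv (hurwitzZeta a) (-k)) n

end CoefficientsAtIntegers

section Negapolygamma

open HurwitzZeta MeasureTheory Set

theorem negapolygamma_add_one_of_le_one (k : ℕ) {q : ℝ} (hq : q ≤ 1) :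
    negapolygamma (k + 1) q =
      (k.factorial : ℂ)⁻¹ * deriv (hurwitzZeta (q : UnitAddCircle)) (-k) +
        -(harmonic k / (k + 1).factorial : ℂ) * (bernoulliFun (k + 1) q : ℂ) := by
  have aeval_bernoulli : Polynomial.aeval (q : ℂ) (Polynomial.bernoulli (k + 1)) =
      (bernoulliFun (k + 1) q : ℂ) := by
    rw [bernoulliFun, Polynomial.eval_map_algebraMap]
    exact Polynomial.aeval_algebraMap_apply ℂ q _
  have factorial_succ : ((k + 1).factorial : ℂ) = (k + 1) * k.factorial := by
    exact_mod_cast k.factorial_succ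
  have succ_ne_zero : (k + 1 : ℂ) ≠ 0 := k.cast_add_one_ne_zero
  simp only [negapolygamma, hurwitzA, aeval_bernoulli, hurwitzZetaFn_of_le_one _ hq,
    factorial_succ, Nat.add_sub_cancel, Nat.cast_add, Nat.cast_one, sub_add_cancel_right]
  field_simp
  ring

theorem negapolygamma_one {q : ℝ} (hq0 : 0 < q) (hq1 : q ≤ 1) :
    negapolygamma 1 q = ((Real.log (Real.Gamma q) - Real.log √(2 * Real.pi) : ℝ) : ℂ) := by
  rw [← deriv_hurwitzZeta_zero hq0 hq1]
  simpa using negapolygamma_add_one_of_le_one 0 hq1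

theorem negapolygamma_add_one_ae_eq (k : ℕ) :
    negapolygamma (k + 1) =ᵐ[volume.restrict (Ioc 0 1)]
      (fun q : ℝ => (k.factorial : ℂ)⁻¹ * deriv (hurwitzZeta (q : UnitAddCircle)) (-k)) +
        fun q => -(harmonic k / (k + 1).factorial : ℂ) * (bernoulliFun (k + 1) q : ℂ) :=
  ae_restrict_of_forall_mem measurableSet_Ioc fun _ hq => negapolygamma_add_one_of_le_one k hq.2

theorem memLp_bernoulliFun (k : ℕ) (p : ENNReal) :
    MemLp (fun q : ℝ => (bernoulliFun k q : ℂ)) p (volume.restrict (Ioc 0 1)) :=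
  memLp_restrict_Ioc_of_continuous (Complex.continuous_ofReal.comp (Polynomial.continuous _)) 0 1 p

theorem memLp_negapolygamma {k : ℕ} (hk : k ≠ 0) {p : ENNReal} (hp : p ≠ ⊤) :
    MemLp (negapolygamma k) p (volume.restrict (Ioc 0 1)) := by
  obtain ⟨k, rfl⟩ := Nat.exists_eq_succ_of_ne_zero hk
  exact (((memLp_deriv_hurwitzZeta_neg_natCast k hp).const_mul _).add
    ((memLp_bernoulliFun (k + 1) p).const_mul _)).ae_eq (negapolygamma_add_one_ae_eq k).symm

theorem intervalIntegrable_of_memLp_one {f : ℝ → ℂ} {a b : ℝ} (hab : a ≤ b)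
    (hf : MemLp f 1 (volume.restrict (Ioc a b))) : IntervalIntegrable f volume a b :=
  (intervalIntegrable_iff_integrableOn_Ioc_of_le hab).mpr (memLp_one_iff_integrable.mp hf)

/-- For `n = 0` the right-hand side is `γ / 0 = 0`, which is indeed the mean of `ψ^(-k)`. -/
theorem fourierCoeffOn_negapolygamma {k : ℕ} (hk : k ≠ 0) (n : ℤ) :
    fourierCoeffOn (zero_lt_one' ℝ) (negapolygamma k) n =
      (Real.eulerMascheroniConstant + Complex.log (2 * Real.pi * Complex.I * n)) /
        (2 * Real.pi * Complex.I * n) ^ k := by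
  obtain ⟨k, rfl⟩ := Nat.exists_eq_succ_of_ne_zero hk
  have bernoulli_coeff := bernoulliFourierCoeff_eq k.succ_ne_zero n
  rw [bernoulliFourierCoeff] at bernoulli_coeff
  have factorial_ne_zero : (k.factorial : ℂ) ≠ 0 := Nat.cast_ne_zero.mpr k.factorial_ne_zero
  have factorial_succ_ne_zero : ((k + 1).factorial : ℂ) ≠ 0 :=
    Nat.cast_ne_zero.mpr (k + 1).factorial_ne_zero
  rw [Nat.succ_eq_add_one, fourierCoeffOn_congr_ae _ (negapolygamma_add_one_ae_eq k),
    fourierCoeffOn_add _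
      ((intervalIntegrable_of_memLp_one zero_le_one
        (memLp_deriv_hurwitzZeta_neg_natCast k ENNReal.one_ne_top)).const_mul _)
      ((intervalIntegrable_of_memLp_one zero_le_one (memLp_bernoulliFun (k + 1) 1)).const_mul _),
    fourierCoeffOn.const_mul, fourierCoeffOn.const_mul, bernoulli_coeff,
    fourierCoeffOn_deriv_hurwitzZeta_neg_natCast, deriv_hurwitzFourierCoeff_natCast_add_one]
  simp only [div_eq_mul_inv]
  field_simp
  ring

theorem integral_negapolygamma {k : ℕ} (hk : k ≠ 0) :
    ∫ q in (0 : ℝ)..1, negapolygamma k q = 0 := by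
  simpa [hk, fourierCoeffOn_zero_left_eq_integral] using fourierCoeffOn_negapolygamma hk 0

end Negapolygamma

section FourierCoefficientProducts

open Complex

theorem inv_I_pow_mul_inv_neg_I_pow_add (k k' : ℕ) :
    (((-I) ^ k * I ^ k')⁻¹ + (I ^ k * (-I) ^ k')⁻¹ : ℂ) =
      2 * (Real.cos (((k : ℝ) - (k' : ℝ)) * (Real.pi / 2)) : ℂ) := by
  have I_pow (j : ℕ) : I ^ j = exp (j * (Real.pi / 2 * I)) := by
    rw [exp_nat_mul, exp_pi_div_two_mul_I]
  have neg_I_pow (j : ℕ) : (-I) ^ j = exp (-(j * (Real.pi / 2 * I))) := by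
    rw [← mul_neg, exp_nat_mul, exp_neg, exp_pi_div_two_mul_I, inv_I]
  rw [I_pow, neg_I_pow, I_pow, neg_I_pow, ← exp_add, ← exp_add, ← exp_neg, ← exp_neg, ofReal_cos,
    two_cos]
  push_cast
  ring_nf

theorem log_two_pi_I_mul_natCast {n : ℕ} (hn : n ≠ 0) :
    log (2 * Real.pi * I * n) = Real.log (2 * Real.pi) + Real.log n + Real.pi / 2 * I := by
  have hpos : 0 < 2 * Real.pi * n := by positivity
  rw [show (2 * Real.pi * I * n : ℂ) = (2 * Real.pi * n : ℝ) * I by push_cast; ring,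
    log_ofReal_mul hpos I_ne_zero, Real.log_mul (by positivity) (by positivity), log_I, ofReal_add]

theorem log_two_pi_I_mul_neg_natCast {n : ℕ} (hn : n ≠ 0) :
    log (2 * Real.pi * I * -n) = Real.log (2 * Real.pi) + Real.log n - Real.pi / 2 * I := by
  have hpos : 0 < 2 * Real.pi * n := by positivity
  rw [show (2 * Real.pi * I * -n : ℂ) = (2 * Real.pi * n : ℝ) * -I by push_cast; ring,
    log_ofReal_mul hpos (neg_ne_zero.mpr I_ne_zero), Real.log_mul (by positivity) (by positivity),
    log_neg_I, ofReal_add]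
  ring

theorem fourierCoeffOn_negapolygamma_mul_add {k k' : ℕ} (hk : k ≠ 0) (hk' : k' ≠ 0) (n : ℕ) :
    fourierCoeffOn (zero_lt_one' ℝ) (negapolygamma k) (-n) *
          fourierCoeffOn (zero_lt_one' ℝ) (negapolygamma k') n +
        fourierCoeffOn (zero_lt_one' ℝ) (negapolygamma k) n *
          fourierCoeffOn (zero_lt_one' ℝ) (negapolygamma k') (-n) =
      2 * (Real.cos (((k : ℝ) - (k' : ℝ)) * (Real.pi / 2)) : ℂ) / (2 * Real.pi) ^ (k + k') *
        (((Real.eulerMascheroniConstant + Real.log (2 * Real.pi) + Real.log n) ^ 2 +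
          Real.pi ^ 2 / 4) / n ^ (k + k')) := by
  simp only [fourierCoeffOn_negapolygamma hk, fourierCoeffOn_negapolygamma hk', Int.cast_neg,
    Int.cast_natCast]
  rcases eq_or_ne n 0 with rfl | hn
  · simp [hk, hk']
  rw [log_two_pi_I_mul_natCast hn, log_two_pi_I_mul_neg_natCast hn,
    ← inv_I_pow_mul_inv_neg_I_pow_add,
    show (2 * Real.pi * I * -n : ℂ) = 2 * Real.pi * n * -I by ring,
    show (2 * Real.pi * I * n : ℂ) = 2 * Real.pi * n * I by ring]
  set c : ℂ := Real.eulerMascheroniConstant + Real.log (2 * Real.pi) + Real.log n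
  have numerator : (c + Real.pi / 2 * I) * (c - Real.pi / 2 * I) = c ^ 2 + Real.pi ^ 2 / 4 := by
    linear_combination -(Real.pi : ℂ) ^ 2 / 4 * I_sq
  rw [← numerator, mul_pow _ I, mul_pow _ I, mul_pow _ (-I), mul_pow _ (-I), mul_pow _ (n : ℂ),
    mul_pow _ (n : ℂ)]
  simp only [pow_add, div_eq_mul_inv, mul_inv, c]
  ring

end FourierCoefficientProducts

section Dirichlet

open Complex LSeries

theorem hasSum_riemannZeta_log_sq {s : ℂ} (hs : 1 < s.re) (c d : ℂ) :
    HasSum (fun n : ℕ => ((c + Real.log n) ^ 2 + d) / (n : ℂ) ^ s)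
      (iteratedDeriv 2 riemannZeta s - 2 * c * deriv riemannZeta s +
        (c ^ 2 + d) * riemannZeta s) := by
  have hs0 : s ≠ 0 := by
    rintro rfl
    exact not_lt_of_ge zero_le_one hs
  have abscissa : abscissaOfAbsConv 1 < s.re := by
    rw [abscissaOfAbsConv_one]
    exact_mod_cast hs
  have zeta_eq : riemannZeta =ᶠ[nhds s] LSeries 1 := by
    filter_upwards [(isOpen_lt continuous_const continuous_re).mem_nhds hs] with w hw
    exact (LSeries_one_eq_riemannZeta hw).symm
  have hasSum_logMul : HasSum (term (logMul 1) s) (LSeries (logMul 1) s) :=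
    (LSeriesSummable_logMul_of_lt_re abscissa).LSeriesHasSum
  have hasSum_logMul_sq : HasSum (term (logMul (logMul 1)) s) (LSeries (logMul (logMul 1)) s) :=
    (LSeriesSummable_logMul_of_lt_re
      (abscissaOfAbsConv_logMul.trans_lt abscissa)).LSeriesHasSum
  have sum := (hasSum_logMul_sq.add (hasSum_logMul.mul_left (2 * c))).add
    ((LSeriesSummable_of_abscissaOfAbsConv_lt_re abscissa).LSeriesHasSum.mul_left (c ^ 2 + d))
  have iteratedDeriv_two : iteratedDeriv 2 (LSeries 1) s = LSeries (logMul (logMul 1)) s := by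
    rw [LSeries_iteratedDeriv 2 abscissa, neg_one_sq, one_mul]
    rfl
  rw [zeta_eq.iteratedDeriv_eq, zeta_eq.deriv_eq, zeta_eq.eq_of_nhds, iteratedDeriv_two,
    LSeries_deriv abscissa, mul_neg, sub_neg_eq_add]
  refine sum.congr_fun fun n => ?_
  simp only [term_of_ne_zero' hs0, logMul, Pi.one_apply, natCast_log]
  ring

end Dirichlet

section Integrals

open Complex MeasureTheory

theorem intervalIntegrable_negapolygamma {k : ℕ} (hk : k ≠ 0) :
    IntervalIntegrable (negapolygamma k) volume 0 1 :=
  intervalIntegrable_of_memLp_one zero_le_one (memLp_negapolygamma hk ENNReal.one_ne_top)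

theorem intervalIntegrable_negapolygamma_mul {k k' : ℕ} (hk : k ≠ 0) (hk' : k' ≠ 0) :
    IntervalIntegrable (fun q => negapolygamma k q * negapolygamma k' q) volume 0 1 :=
  (intervalIntegrable_iff_integrableOn_Ioc_of_le zero_le_one).mpr
    (MemLp.integrable_mul (p := 2) (q := 2) (memLp_negapolygamma hk ENNReal.ofNat_ne_top)
      (memLp_negapolygamma hk' ENNReal.ofNat_ne_top))

theorem integral_negapolygamma_mul {k k' : ℕ} (hk : k ≠ 0) (hk' : k' ≠ 0) :
    ∫ q in (0 : ℝ)..1, negapolygamma k q * negapolygamma k' q =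
      2 * (Real.cos (((k : ℝ) - (k' : ℝ)) * (Real.pi / 2)) : ℂ) / (2 * Real.pi) ^ (k + k') *
        (iteratedDeriv 2 riemannZeta (k + k') -
          2 * (Real.eulerMascheroniConstant + Real.log (2 * Real.pi)) *
            deriv riemannZeta (k + k') +
          ((Real.eulerMascheroniConstant + Real.log (2 * Real.pi)) ^ 2 + Real.pi ^ 2 / 4) *
            riemannZeta (k + k')) := by
  have parseval := (hasSum_fourierCoeffOn_neg_mul (zero_lt_one' ℝ)
    (memLp_negapolygamma hk ENNReal.ofNat_ne_top)
    (memLp_negapolygamma hk' ENNReal.ofNat_ne_top)).nat_add_neg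
  have hre : 1 < (k + k' : ℂ).re := by
    rw [← Nat.cast_add, natCast_re]
    exact_mod_cast Nat.lt_of_lt_of_le one_lt_two
      (add_le_add (Nat.one_le_iff_ne_zero.mpr hk) (Nat.one_le_iff_ne_zero.mpr hk'))
  have coeff_zero : fourierCoeffOn (zero_lt_one' ℝ) (negapolygamma k') 0 = 0 := by
    simp [fourierCoeffOn_negapolygamma hk', hk']
  rw [coeff_zero, mul_zero, add_zero, sub_zero, inv_one, one_smul] at parseval
  refine parseval.unique (((hasSum_riemannZeta_log_sq hre _ _).mul_left _).congr_fun fun n => ?_)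
  rw [neg_neg, fourierCoeffOn_negapolygamma_mul_add hk hk', ← Nat.cast_add, cpow_natCast]

theorem eqOn_log_Gamma_sq :
    Set.EqOn (fun q : ℝ => ((Real.log (Real.Gamma q) ^ 2 : ℝ) : ℂ))
      (fun q => negapolygamma 1 q * negapolygamma 1 q +
        2 * Real.log √(2 * Real.pi) * negapolygamma 1 q + Real.log √(2 * Real.pi) ^ 2)
      (Set.uIoc 0 1) := fun q hq => by
  rw [Set.uIoc_of_le zero_le_one] at hq
  dsimp only
  rw [negapolygamma_one hq.1 hq.2]
  push_cast
  ring

theorem intervalIntegrable_log_Gamma_sq :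
    IntervalIntegrable (fun q => Real.log (Real.Gamma q) ^ 2) volume 0 1 := by
  have complex_valued : IntervalIntegrable (fun q => ((Real.log (Real.Gamma q) ^ 2 : ℝ) : ℂ))
      volume 0 1 :=
    (((intervalIntegrable_negapolygamma_mul one_ne_zero one_ne_zero).add
      ((intervalIntegrable_negapolygamma one_ne_zero).const_mul _)).add
        intervalIntegrable_const).congr eqOn_log_Gamma_sq.symm
  exact ⟨complex_valued.1.re, complex_valued.2.re⟩

theorem integral_log_Gamma_sq :
    ((∫ q in (0 : ℝ)..1, Real.log (Real.Gamma q) ^ 2 : ℝ) : ℂ) =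
      (∫ q in (0 : ℝ)..1, negapolygamma 1 q * negapolygamma 1 q) +
        Real.log √(2 * Real.pi) ^ 2 := by
  have hψ := intervalIntegrable_negapolygamma one_ne_zero
  have hψψ := intervalIntegrable_negapolygamma_mul one_ne_zero one_ne_zero
  rw [← intervalIntegral.integral_ofReal,
    intervalIntegral.integral_congr_ae (Filter.Eventually.of_forall eqOn_log_Gamma_sq),
    intervalIntegral.integral_add (hψψ.add (hψ.const_mul _)) intervalIntegrable_const,
    intervalIntegral.integral_add hψψ (hψ.const_mul _), intervalIntegral.integral_const_mul,
    integral_negapolygamma one_ne_zero, intervalIntegral.integral_const, mul_zero, add_zero,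
    sub_zero, one_smul]

end Integrals

theorem mainTheorem10 :
    (∀ k k' : ℕ, 1 ≤ k → 1 ≤ k' →
      IntervalIntegrable (fun q : ℝ => negapolygamma k q * negapolygamma k' q)
        MeasureTheory.volume 0 1 ∧
      ∫ q in (0 : ℝ)..1, negapolygamma k q * negapolygamma k' q =
        2 * (Real.cos (((k : ℝ) - (k' : ℝ)) * (Real.pi / 2)) : ℂ) /
            (2 * (Real.pi : ℂ)) ^ (k + k') *
          (iteratedDeriv 2 riemannZeta ((k : ℂ) + (k' : ℂ))
            - 2 * ((Real.eulerMascheroniConstant : ℂ) + (Real.log (2 * Real.pi) : ℂ)) *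
                deriv riemannZeta ((k : ℂ) + (k' : ℂ))
            + (((Real.eulerMascheroniConstant : ℂ) + (Real.log (2 * Real.pi) : ℂ)) ^ 2
                + (Real.pi : ℂ) ^ 2 / 4) * riemannZeta ((k : ℂ) + (k' : ℂ)))) ∧
    IntervalIntegrable (fun q : ℝ => Real.log (Real.Gamma q) ^ 2) MeasureTheory.volume 0 1 ∧
    ((∫ q in (0 : ℝ)..1, Real.log (Real.Gamma q) ^ 2 : ℝ) : ℂ) =
      (Real.eulerMascheroniConstant : ℂ) ^ 2 / 12 + (Real.pi : ℂ) ^ 2 / 48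
        + 1 / 3 * (Real.eulerMascheroniConstant : ℂ) * (Real.log (Real.sqrt (2 * Real.pi)) : ℂ)
        + 4 / 3 * (Real.log (Real.sqrt (2 * Real.pi)) : ℂ) ^ 2
        - ((Real.eulerMascheroniConstant : ℂ) + 2 * (Real.log (Real.sqrt (2 * Real.pi)) : ℂ)) *
            (deriv riemannZeta 2 / (Real.pi : ℂ) ^ 2)
        + iteratedDeriv 2 riemannZeta 2 / (2 * (Real.pi : ℂ) ^ 2) := by
  refine ⟨fun k k' hk hk' => ?_, intervalIntegrable_log_Gamma_sq, ?_⟩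
  · have hk0 : k ≠ 0 := Nat.one_le_iff_ne_zero.mp hk
    have hk0' : k' ≠ 0 := Nat.one_le_iff_ne_zero.mp hk'
    exact ⟨intervalIntegrable_negapolygamma_mul hk0 hk0', integral_negapolygamma_mul hk0 hk0'⟩
  · rw [integral_log_Gamma_sq, integral_negapolygamma_mul one_ne_zero one_ne_zero,
      Real.log_sqrt Real.two_pi_pos.le]
    have pi_ne_zero : (Real.pi : ℂ) ≠ 0 := Complex.ofReal_ne_zero.mpr Real.pi_ne_zero
    simp only [Nat.cast_one, one_add_one_eq_two, riemannZeta_two, sub_self, zero_mul, Real.cos_zero,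
      Complex.ofReal_one, Complex.ofReal_div, Complex.ofReal_ofNat]
    field_simp
    ring
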